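/- Let $\pi:E\to\mathcal M$ be a smooth real vector bundle of finite rank over a smooth manifold (finite-dimensional, without boundary), let $G$ be a Lie group, and let $\Theta:E\times G\to E$ be a smooth fiber-linear right action: $\Theta$ is a smooth right action, and every $\Theta_g=\Theta(\cdot,g)$ covers a map $\theta_g:\mathcal M\to\mathcal M$ and restricts to linear maps $E_p\to E_{\theta_g(p)}$. For $\xi\in\mathrm{Lie}(G)$ let $$\hat\Theta(\xi)_x=\tfrac{d}{dt}\big|_{t=0}\Theta_{\exp(t\xi)}(x)\in T_xE$$ be the infinitesimal generator, and for a section $F$ of $E$ let $$(\mathcal L_\xi F)(p)=\lim_{t\to0}\tfrac1t\Big(\Theta_{\exp(t\xi)^{-1}}\big(F(\theta_{\exp(t\xi)}(p))\big)-F(p)\Big)\in E_p$$ be the Lie derivative, defined when this limit exists for every $p\in\mathcal M$. Let $F:\mathcal M\to E$ be a smooth section. Then: 1. There is a unique family of maps $\imath_F:E_p\to T_{F(p)}E$, $p\in\mathcal M$, which in every smooth local trivialization $\Phi:\pi^{-1}(\mathcal U)\to\mathcal U\times\mathbb R^k$ is given by $D\Phi\circ\imath_F\circ\Phi^{-1}(p,v)=(0,v)\in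 T_{\Phi(F(p))}(\mathcal U\times\mathbb R^k)$. It is linear on each fiber, and the resulting map $\imath_F:E\to TE$ (the vertical lift along $F$), which covers $F$, is smooth and injective; that is, it is an injective smooth vector bundle homomorphism. 2. For every $p\in\mathcal M$, the map $P_{F(p)}:=D(F\circ\pi)(F(p)):T_{F(p)}E\to T_{F(p)}E$ is a linear projection ($P_{F(p)}^2=P_{F(p)}$) whose range is the tangent space $T_{F(p)}\,\mathrm{image}(F)$. Here $T_{F(p)}\,\mathrm{image}(F)$ is the set of velocities at time $0$ of smooth curves in $E$ which lie in $\mathrm{image}(F)$ and pass through $F(p)$ at time $0$; it equals the range of $DF(p)$. 3. For every $\xi\in\mathrm{Lie}(G)$, the Lie derivative $\mathcal L_\xi F$ exists, and for every $p\in\mathcal M$ $$\imath_F\big((\mathcal L_\xi F)(p)\big)=-\big[I-P_{F(p)}\big]\hat\Theta(\xi)_{F(p)}.$$ 4. For every $\xi\in\mathrm{Lie}(G)$ and $p\in\mathcal M$: $(\mathcal L_\xi F)(p)=0$ if and only if $\hat\Theta(\xi)_{F(p)}\in T_{F(p)}\,\mathrm{image}(F)$. -/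

import Mathlib

open Set Filter Topology Bundle
open scoped Manifold ContDiff

noncomputable section

/-! ### The exponential map of a Lie group -/

section LieExp

variable {EG HG G : Type*} [NormedAddCommGroup EG] [NormedSpace ℝ EG]
  [TopologicalSpace HG] {IG : ModelWithCorners ℝ EG HG}
  [TopologicalSpace G] [ChartedSpace HG G] [Group G] [LieGroup IG ∞ G]

/-- Left-invariant vector fields are invariant under left translations. -/
theorem mfderiv_mul_left_mulInvariantVectorField (ξ : GroupLieAlgebra IG G) (g h : G) :
    mfderiv IG IG (fun x : G ↦ g * x) h (mulInvariantVectorField ξ h) =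
      mulInvariantVectorField ξ (g * h) := by
  have M : (∞ : WithTop ℕ∞) ≠ 0 := by simp
  have D : (fun x : G ↦ g * h * x) = (fun x : G ↦ g * x) ∘ (fun x : G ↦ h * x) := by
    ext x
    simp [mul_assoc]
  have h1 : MDifferentiableAt IG IG (fun x : G ↦ h * x) 1 :=
    (contMDiff_mul_left (I := IG) (n := ∞)).contMDiffAt.mdifferentiableAt M
  have h2 : MDifferentiableAt IG IG (fun x : G ↦ g * x) (h * 1) :=
    (contMDiff_mul_left (I := IG) (n := ∞)).contMDiffAt.mdifferentiableAt M
  have h3 := mfderiv_comp (I := IG) (I' := IG) (I'' := IG) (1 : G) h2 h1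
  have e : ∀ k : G, k = h → (mfderiv IG IG (fun x : G ↦ g * x) h : EG →L[ℝ] EG) =
      (mfderiv IG IG (fun x : G ↦ g * x) k : EG →L[ℝ] EG) := by
    rintro _ rfl
    rfl
  simp only [mulInvariantVectorField]
  rw [D, h3]
  exact congrArg (fun L : EG →L[ℝ] EG ↦ L (mfderiv IG IG (fun x : G ↦ h * x) 1 ξ))
    (e (h * 1) (mul_one h))

variable [FiniteDimensional ℝ EG] [BoundarylessManifold IG G] [T2Space G]

/-- Left-invariant vector fields on a Lie group are complete: through the identity there passes an
integral curve which is defined for all times. -/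
theorem exists_isMIntegralCurve_mulInvariantVectorField (ξ : GroupLieAlgebra IG G) :
    ∃ γ : ℝ → G, γ 0 = 1 ∧ IsMIntegralCurve (I := IG) γ (mulInvariantVectorField ξ) := by
  have : LieGroup IG (minSmoothness ℝ 3) G := by
    rw [minSmoothness_of_isRCLikeNormedField]
    exact LieGroup.of_le (m := 3) (n := ∞) ENat.LEInfty.out
  have : IsManifold IG 1 G := IsManifold.of_le (n := ∞) ENat.LEInfty.out
  have : CompleteSpace EG := FiniteDimensional.complete ℝ EG
  have hv : ContMDiff IG IG.tangent 1
      (fun g : G ↦ (⟨g, mulInvariantVectorField ξ g⟩ : TangentBundle IG G)) :=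
    (contMDiff_mulInvariantVectorField ξ).of_le
      (by rw [minSmoothness_of_isRCLikeNormedField]; exact one_le_two)
  obtain ⟨γ, hγ0, hγ⟩ := exists_isMIntegralCurveAt_of_contMDiffAt_boundaryless (t₀ := 0)
    (hv.contMDiffAt (x := (1 : G)))
  obtain ⟨ε, hε, hγε⟩ := isMIntegralCurveAt_iff'.1 hγ
  refine exists_isMIntegralCurve_of_isMIntegralCurveOn hv hε (fun g ↦ ?_) 1
  refine ⟨fun t ↦ g * γ t, by simp [hγ0], fun t ht ↦ ?_⟩
  have h1 := hγε t (by simpa [Real.ball_eq_Ioo] using ht)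
  rw [Real.ball_eq_Ioo, zero_sub, zero_add] at h1
  have h2 : MDifferentiableAt IG IG (fun x : G ↦ g * x) (γ t) :=
    (contMDiff_mul_left (I := IG) (n := ∞)).contMDiffAt.mdifferentiableAt (by simp)
  have h3 := h2.hasMFDerivAt.comp_hasMFDerivWithinAt t h1
  refine h3.congr_mfderiv ?_
  refine ContinuousLinearMap.ext fun s ↦ ?_
  have h4 := mfderiv_mul_left_mulInvariantVectorField (IG := IG) ξ g (γ t)
  have h5 := (mfderiv IG IG (fun x : G ↦ g * x) (γ t)).map_smul s
    (mulInvariantVectorField ξ (γ t))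
  rw [h4] at h5
  exact h5

/-- The exponential map `exp : Lie(G) → G` of a Lie group: `exp ξ = γ 1`, where `γ : ℝ → G` is the
integral curve, with `γ 0 = 1`, of the left-invariant vector field whose value at the identity
is `ξ`. (The integral curve is unique by uniqueness of solutions of smooth ODEs.) -/
def lieExp (ξ : GroupLieAlgebra IG G) : G :=
  (exists_isMIntegralCurve_mulInvariantVectorField ξ).choose 1

end LieExp

/-! ### Fiber-linear actions on vector bundles, transformation operators, Lie derivatives -/

section Action

variable {EM HM M : Type*} [NormedAddCommGroup EM] [NormedSpace ℝ EM]
  [TopologicalSpace HM] (IM : ModelWithCorners ℝ EM HM)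
  [TopologicalSpace M] [ChartedSpace HM M]
  {EG HG : Type*} [NormedAddCommGroup EG] [NormedSpace ℝ EG]
  [TopologicalSpace HG] (IG : ModelWithCorners ℝ EG HG)
  (G : Type*) [TopologicalSpace G] [ChartedSpace HG G] [Group G]
  (V : Type*) [NormedAddCommGroup V] [NormedSpace ℝ V]
  (E : M → Type*) [TopologicalSpace (TotalSpace V E)]
  [∀ p, AddCommGroup (E p)] [∀ p, Module ℝ (E p)] [∀ p, TopologicalSpace (E p)]
  [FiberBundle V E]

/-- A smooth fiber-linear right action `Θ` of `G` on the vector bundle `E → M`: every `Θ_g` covers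
a map `θ_g = base · g` of `M` and restricts to linear maps `E_p → E_{θ(p, g)}`, the map
`Θ : E × G → E` is smooth, and `Θ` is a right action. -/
structure FiberLinearRightAction where
  /-- The map `θ : M × G → M` to which the action descends. -/
  base : M → G → M
  /-- The restriction of `Θ_g` to the fiber over `p`. -/
  fiberMap : ∀ (p : M) (g : G), E p →ₗ[ℝ] E (base p g)
  smooth : ContMDiff ((IM.prod 𝓘(ℝ, V)).prod IG) (IM.prod 𝓘(ℝ, V)) ∞
    (fun x : TotalSpace V E × G ↦
      (⟨base x.1.proj x.2, fiberMap x.1.proj x.2 x.1.snd⟩ : TotalSpace V E))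
  map_one : ∀ x : TotalSpace V E,
    (⟨base x.proj 1, fiberMap x.proj 1 x.snd⟩ : TotalSpace V E) = x
  map_mul : ∀ (x : TotalSpace V E) (g h : G),
    (⟨base (base x.proj g) h, fiberMap (base x.proj g) h (fiberMap x.proj g x.snd)⟩ :
      TotalSpace V E) = ⟨base x.proj (g * h), fiberMap x.proj (g * h) x.snd⟩

namespace FiberLinearRightAction

variable {IM IG G V E}

/-- The action map `Θ : E × G → E`. -/
def act (Θ : FiberLinearRightAction IM IG G V E) (x : TotalSpace V E) (g : G) : TotalSpace V E :=
  ⟨Θ.base x.proj g, Θ.fiberMap x.proj g x.snd⟩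

theorem base_base_inv (Θ : FiberLinearRightAction IM IG G V E) (p : M) (g : G) :
    Θ.base (Θ.base p g) g⁻¹ = p := by
  have h1 := congrArg TotalSpace.proj (Θ.map_mul ⟨p, 0⟩ g g⁻¹)
  have h2 := congrArg TotalSpace.proj (Θ.map_one ⟨p, 0⟩)
  simp only [mul_inv_cancel] at h1 h2
  exact h1.trans h2

/-- The transformation operators `K_g F = Θ_{g⁻¹} ∘ F ∘ θ_g` on (rough) sections. The vector
`Θ_{g⁻¹} (F (θ_g p))` is transported along the equality `θ_{g⁻¹} (θ_g p) = p`. -/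
def transform (Θ : FiberLinearRightAction IM IG G V E) (g : G) (F : ∀ p, E p) (p : M) : E p :=
  Θ.base_base_inv p g ▸ Θ.fiberMap (Θ.base p g) g⁻¹ (F (Θ.base p g))

theorem mk_transform (Θ : FiberLinearRightAction IM IG G V E) (g : G) (F : ∀ p, E p) (p : M) :
    (⟨p, Θ.transform g F p⟩ : TotalSpace V E) =
      Θ.act ⟨Θ.base p g, F (Θ.base p g)⟩ g⁻¹ := by
  have key : ∀ (q r : M) (h : q = r) (v : E q),
      (⟨r, h ▸ v⟩ : TotalSpace V E) = ⟨q, v⟩ := by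
    rintro q r rfl v
    rfl
  exact key _ _ (Θ.base_base_inv p g) _

variable [FiniteDimensional ℝ EG] [LieGroup IG ∞ G] [BoundarylessManifold IG G] [T2Space G]

/-- The difference quotients `(1 / t) (K_{exp (t ξ)} F (p) - F (p)) ∈ E_p` which define the
Lie derivative. -/
def lieQuotient (Θ : FiberLinearRightAction IM IG G V E) (ξ : GroupLieAlgebra IG G)
    (F : ∀ p, E p) (p : M) (t : ℝ) : E p :=
  t⁻¹ • (Θ.transform (lieExp (t • ξ)) F p - F p)

/-- `F ∈ D(L_ξ)`: the difference quotients converge pointwise as `t → 0`. -/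
def MemLieDomain (Θ : FiberLinearRightAction IM IG G V E) (ξ : GroupLieAlgebra IG G)
    (F : ∀ p, E p) : Prop :=
  ∀ p, ∃ v : E p, Tendsto (Θ.lieQuotient ξ F p) (𝓝[≠] 0) (𝓝 v)

/-- The Lie derivative `L_ξ F`, the pointwise limit of the difference quotients
(meaningful for `F ∈ D(L_ξ)`). -/
def lieDeriv (Θ : FiberLinearRightAction IM IG G V E) (ξ : GroupLieAlgebra IG G)
    (F : ∀ p, E p) (p : M) : E p :=
  haveI : Nonempty (E p) := ⟨0⟩
  limUnder (𝓝[≠] (0 : ℝ)) (Θ.lieQuotient ξ F p)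

/-- The infinitesimal generator `Θ̂(ξ)_x = d/dt Θ_{exp (t ξ)}(x)` at `t = 0`. It is a tangent vector
at the point `Θ_{exp 0}(x)`, which is `x`. -/
def generator (Θ : FiberLinearRightAction IM IG G V E) (ξ : GroupLieAlgebra IG G)
    (x : TotalSpace V E) : TangentSpace (IM.prod 𝓘(ℝ, V)) x :=
  (mfderiv 𝓘(ℝ, ℝ) (IM.prod 𝓘(ℝ, V)) (fun t : ℝ ↦ Θ.act x (lieExp (t • ξ))) 0 (1 : ℝ) : EM × V)

end FiberLinearRightAction

end Action

/-! ### Tangent vectors to subsets, vertical lift -/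

section Tangent

variable {E' H' N : Type*} [NormedAddCommGroup E'] [NormedSpace ℝ E'] [TopologicalSpace H']
  (I' : ModelWithCorners ℝ E' H') [TopologicalSpace N] [ChartedSpace H' N]

/-- The tangent space at `x` of a submanifold `S`, as a subset of the tangent space at `x` of the
ambient manifold: the velocities at time `0` of the smooth curves through `x` which stay in `S`. -/
def submanifoldTangent (S : Set N) (x : N) : Set (TangentSpace I' x) :=
  {v | ∃ (γ : ℝ → N) (ε : ℝ), 0 < ε ∧ ContMDiffOn 𝓘(ℝ, ℝ) I' ∞ γ (Ioo (-ε) ε) ∧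
    (∀ t ∈ Ioo (-ε) ε, γ t ∈ S) ∧ γ 0 = x ∧
    (mfderiv 𝓘(ℝ, ℝ) I' γ 0 (1 : ℝ) : E') = v}

end Tangent

section Bundle

variable {EM HM M : Type*} [NormedAddCommGroup EM] [NormedSpace ℝ EM]
  [TopologicalSpace HM] (IM : ModelWithCorners ℝ EM HM)
  [TopologicalSpace M] [ChartedSpace HM M]
  (V : Type*) [NormedAddCommGroup V] [NormedSpace ℝ V]
  {E : M → Type*} [TopologicalSpace (TotalSpace V E)]
  [∀ p, AddCommGroup (E p)] [∀ p, Module ℝ (E p)] [∀ p, TopologicalSpace (E p)]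
  [FiberBundle V E]

/-- A section `F`, viewed as a map from the base to the total space. -/
def sectionMap (F : ∀ p, E p) (p : M) : TotalSpace V E := ⟨p, F p⟩

variable {V} in
/-- A smooth local trivialization of a vector bundle: a fiberwise linear diffeomorphism
`Φ : π⁻¹(U) → U × V` over an open set `U` of the base. -/
structure IsSmoothLocalTrivialization (Φ : Trivialization V (π V E)) : Prop where
  linear : Φ.IsLinear ℝ
  smooth : ContMDiffOn (IM.prod 𝓘(ℝ, V)) (IM.prod 𝓘(ℝ, V)) ∞ Φ Φ.source
  smooth_symm : ContMDiffOn (IM.prod 𝓘(ℝ, V)) (IM.prod 𝓘(ℝ, V)) ∞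
    Φ.toOpenPartialHomeomorph.symm Φ.target

/-- The family of maps `ι p : E_p → T_{F(p)} E` is the vertical lift along the section `F`: in every
smooth local trivialization `Φ : π⁻¹(U) → U × V` it is given by
`(DΦ ∘ ι ∘ Φ⁻¹) (p, v) = (0, v)` in the tangent space of `U × V` at `Φ (F p)`. -/
def IsVerticalLift (F : ∀ p, E p)
    (ι : ∀ p, E p → TangentSpace (IM.prod 𝓘(ℝ, V)) (sectionMap V F p)) : Prop :=
  ∀ Φ : Trivialization V (π V E), IsSmoothLocalTrivialization IM Φ →
    ∀ p ∈ Φ.baseSet, ∀ (w : E p) (v : V), Φ ⟨p, w⟩ = (p, v) →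
      (mfderiv (IM.prod 𝓘(ℝ, V)) (IM.prod 𝓘(ℝ, V)) Φ (sectionMap V F p) (ι p w) : EM × V) = (0, v)

/-- The derivative `P = D(F ∘ π)(F(p)) : T_{F(p)} E → T_{F(p)} E`. -/
def sectionProj (F : ∀ p, E p) (p : M) :
    TangentSpace (IM.prod 𝓘(ℝ, V)) (sectionMap V F p) →L[ℝ]
      TangentSpace (IM.prod 𝓘(ℝ, V)) (sectionMap V F p) :=
  mfderiv (IM.prod 𝓘(ℝ, V)) (IM.prod 𝓘(ℝ, V)) (sectionMap V F ∘ TotalSpace.proj)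
    (sectionMap V F p)

end Bundle

end

/-!
Everything is read off from velocities of curves.

The vertical lift of `w ∈ E_p` is the velocity at time `0` of the straight line `t ↦ F(p) + t w` in
`E_p`. A smooth local trivialization `Φ` is linear on `E_p` and maps this line to a straight line in
`{p} × V`, which gives the characterization of the vertical lift; uniqueness and injectivity hold
because `DΦ` is injective, and smoothness because in a local trivialization the vertical lift is the
tangent map of `Φ⁻¹` applied to a smooth field of vertical vectors.

Since `π ∘ F = id`, the chain rule shows that `P = DF ∘ Dπ` fixes the range of `DF`, hence is a
projection onto it. A curve `γ` in the image of `F` satisfies `γ = F ∘ π ∘ γ`, so that its velocity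
is fixed by `P`; this identifies the range of `P` with the tangent space of the image.

For the Lie derivative, let `c(t) = exp (t ξ)` and let `x(t) = Θ_{c(t)⁻¹}(F(θ_{c(t)}(p)))`, a curve
in `E_p` through `F(p)`. It satisfies `Θ_{c(t)}(x(t)) = F(π(Θ_{c(t)}(F(p))))`. Differentiating at
`t = 0`, the left side gives `x'(0) + Θ̂(ξ)` and the right side `P Θ̂(ξ)`
(`FiberLinearRightAction.hasVelocity_transform`). A curve in `E_p` which is differentiable in `E`
is differentiable in the vector space `E_p`, and its velocity is the vertical lift of its derivative
(`HasVelocity.exists_tendsto_verticalLift_eq`); for `x` that derivative is the Lie derivative.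
-/

noncomputable section

/-! ### Velocities of curves -/

section Velocity

variable {E' H' N : Type*} [NormedAddCommGroup E'] [NormedSpace ℝ E'] [TopologicalSpace H']
  {I' : ModelWithCorners ℝ E' H'} [TopologicalSpace N] [ChartedSpace H' N]
  {E'' H'' N' : Type*} [NormedAddCommGroup E''] [NormedSpace ℝ E''] [TopologicalSpace H'']
  {I'' : ModelWithCorners ℝ E'' H''} [TopologicalSpace N'] [ChartedSpace H'' N']

variable (I') in
/-- The curve `γ` passes through `x` at time `0`, with velocity `v` there. The tangent vector is
taken in the model space `E'`, to which `TangentSpace I' x` unfolds for every `x`, so that the base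
point may be replaced by a propositionally equal one. -/
def HasVelocity (γ : ℝ → N) (x : N) (v : E') : Prop :=
  γ 0 = x ∧ HasMFDerivAt 𝓘(ℝ, ℝ) I' γ 0 ((1 : ℝ →L[ℝ] ℝ).smulRight v)

namespace HasVelocity

variable {γ δ : ℝ → N} {x : N} {v w : E'}

theorem mfderiv_apply_one (h : HasVelocity I' γ x v) :
    (mfderiv 𝓘(ℝ, ℝ) I' γ 0 (1 : ℝ) : E') = v := by
  rw [h.2.mfderiv]
  exact one_smul ℝ v

theorem unique {y : N} (h : HasVelocity I' γ x v) (h' : HasVelocity I' γ y w) : v = w :=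
  h.mfderiv_apply_one.symm.trans h'.mfderiv_apply_one

theorem mdifferentiableAt (h : HasVelocity I' γ x v) : MDifferentiableAt 𝓘(ℝ, ℝ) I' γ 0 :=
  h.2.mdifferentiableAt

theorem of_mdifferentiableAt (hγ : MDifferentiableAt 𝓘(ℝ, ℝ) I' γ 0) (hx : γ 0 = x)
    (hv : (mfderiv 𝓘(ℝ, ℝ) I' γ 0 (1 : ℝ) : E') = v) : HasVelocity I' γ x v := by
  refine ⟨hx, ?_⟩
  subst hv
  refine hγ.hasMFDerivAt.congr_mfderiv ?_
  refine ContinuousLinearMap.ext_ring ?_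
  exact (one_smul ℝ (mfderiv 𝓘(ℝ, ℝ) I' γ 0 (1 : ℝ) : E')).symm

theorem congr (h : HasVelocity I' γ x v) (hδ : δ =ᶠ[𝓝 0] γ) : HasVelocity I' δ x v :=
  ⟨hδ.self_of_nhds.trans h.1, h.2.congr_of_eventuallyEq hδ⟩

theorem map {f : N → N'} (h : HasVelocity I' γ x v) (hf : MDifferentiableAt I' I'' f x) :
    HasVelocity I'' (fun t ↦ f (γ t)) (f x) (mfderiv I' I'' f x v) := by
  obtain ⟨rfl, h⟩ := h
  refine ⟨rfl, (hf.hasMFDerivAt.comp 0 h).congr_mfderiv ?_⟩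
  refine ContinuousLinearMap.ext fun s ↦ ?_
  exact (mfderiv I' I'' f (γ 0)).map_smul s v

theorem prodMk {γ' : ℝ → N'} {x' : N'} {v' : E''} (h : HasVelocity I' γ x v)
    (h' : HasVelocity I'' γ' x' v') :
    HasVelocity (I'.prod I'') (fun t ↦ (γ t, γ' t)) (x, x') (v, v') := by
  obtain ⟨rfl, h⟩ := h
  obtain ⟨rfl, h'⟩ := h'
  exact ⟨rfl, h.prodMk h'⟩

theorem fst {γ : ℝ → N × N'} {x : N × N'} {v : E' × E''} (h : HasVelocity (I'.prod I'') γ x v) :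
    HasVelocity I' (fun t ↦ (γ t).1) x.1 v.1 := by
  have := h.map (f := Prod.fst) mdifferentiableAt_fst
  rwa [mfderiv_fst] at this

theorem snd {γ : ℝ → N × N'} {x : N × N'} {v : E' × E''} (h : HasVelocity (I'.prod I'') γ x v) :
    HasVelocity I'' (fun t ↦ (γ t).2) x.2 v.2 := by
  have := h.map (f := Prod.snd) mdifferentiableAt_snd
  rwa [mfderiv_snd] at this

theorem const : HasVelocity I' (fun _ ↦ x) x (0 : E') :=
  ⟨rfl, (hasMFDerivAt_const x 0).congr_mfderiv 
    (ContinuousLinearMap.ext fun s ↦ (smul_zero (A := E') (show ℝ from s)).symm)⟩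

/-- Leibniz rule: the velocity of `t ↦ f(γ(t), δ(t))` is the sum of the velocities obtained by
freezing one of the two arguments. -/
theorem map₂ {E₃ H₃ N₃ : Type*} [NormedAddCommGroup E₃] [NormedSpace ℝ E₃] [TopologicalSpace H₃]
    {I₃ : ModelWithCorners ℝ E₃ H₃} [TopologicalSpace N₃] [ChartedSpace H₃ N₃]
    {f : N → N' → N₃} {γ' : ℝ → N'} {x' : N'} {v' : E''} {y z : N₃} {a b : E₃}
    (hf : MDifferentiableAt (I'.prod I'') I₃ (fun z : N × N' ↦ f z.1 z.2) (x, x'))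
    (h : HasVelocity I' γ x v) (h' : HasVelocity I'' γ' x' v')
    (ha : HasVelocity I₃ (fun t ↦ f (γ t) x') y a)
    (hb : HasVelocity I₃ (fun t ↦ f x (γ' t)) z b) :
    HasVelocity I₃ (fun t ↦ f (γ t) (γ' t)) (f x x') (a + b) := by
  set D : E' × E'' →L[ℝ] E₃ :=
    mfderiv (I'.prod I'') I₃ (fun z : N × N' ↦ f z.1 z.2) (x, x')
  have h1 : D (v, 0) = a := ((h.prodMk (.const (x := x'))).map hf).unique ha
  have h2 : D (0, v') = b := (((const (I' := I') (x := x)).prodMk h').map hf).unique hb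
  have h3 : a + b = D (v, v') := by
    rw [← h1, ← h2, ← map_add, Prod.mk_add_mk, add_zero, zero_add]
  rw [h3]
  exact (h.prodMk h').map hf

end HasVelocity

theorem HasDerivAt.hasVelocity {γ : ℝ → E'} {v : E'} (h : HasDerivAt γ v 0) :
    HasVelocity 𝓘(ℝ, E') γ (γ 0) v := by
  have h1 : HasFDerivAt γ ((1 : ℝ →L[ℝ] ℝ).smulRight v) 0 :=
    h.hasFDerivAt.congr_fderiv (by ext; simp)
  exact ⟨rfl, h1.hasMFDerivAt⟩

theorem HasVelocity.hasDerivAt {γ : ℝ → E'} {x v : E'} (h : HasVelocity 𝓘(ℝ, E') γ x v) :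
    HasDerivAt γ v 0 := by
  have h1 : HasFDerivAt γ ((1 : ℝ →L[ℝ] ℝ).smulRight v) 0 := hasMFDerivAt_iff_hasFDerivAt.1 h.2
  simpa using h1.hasDerivAt

end Velocity

/-! ### One-parameter subgroups -/

section LieExp

variable {EG HG G : Type*} [NormedAddCommGroup EG] [NormedSpace ℝ EG]
  [TopologicalSpace HG] {IG : ModelWithCorners ℝ EG HG}
  [TopologicalSpace G] [ChartedSpace HG G] [Group G] [LieGroup IG ∞ G]
  [FiniteDimensional ℝ EG] [BoundarylessManifold IG G] [T2Space G]

/-- The curve `t ↦ exp (t ξ)` is the integral curve, through the identity, of the left-invariant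
vector field of `ξ`: by uniqueness of integral curves, the one defining `exp (t ξ)` is a
reparametrization of the one defining `exp ξ`. -/
theorem exists_isMIntegralCurve_eq_lieExp (ξ : GroupLieAlgebra IG G) :
    ∃ γ : ℝ → G, γ 0 = 1 ∧ IsMIntegralCurve (I := IG) γ (mulInvariantVectorField ξ) ∧
      ∀ t : ℝ, lieExp (t • ξ) = γ t := by
  have : LieGroup IG (minSmoothness ℝ 3) G := by
    rw [minSmoothness_of_isRCLikeNormedField]
    exact LieGroup.of_le (m := 3) (n := ∞) ENat.LEInfty.out
  have : IsManifold IG 1 G := IsManifold.of_le (n := ∞) ENat.LEInfty.out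
  have : CompleteSpace EG := FiniteDimensional.complete ℝ EG
  have hv (η : GroupLieAlgebra IG G) : ContMDiff IG IG.tangent 1
      (fun g : G ↦ (⟨g, mulInvariantVectorField η g⟩ : TangentBundle IG G)) :=
    (contMDiff_mulInvariantVectorField η).of_le
      (by rw [minSmoothness_of_isRCLikeNormedField]; exact one_le_two)
  obtain ⟨h0, h⟩ := (exists_isMIntegralCurve_mulInvariantVectorField ξ).choose_spec
  refine ⟨_, h0, h, fun t ↦ ?_⟩
  obtain ⟨k0, k⟩ := (exists_isMIntegralCurve_mulInvariantVectorField (t • ξ)).choose_spec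
  have hs : mulInvariantVectorField (t • ξ) = t • (mulInvariantVectorField ξ :
      ∀ g : G, TangentSpace IG g) :=
    funext fun g ↦ (mfderiv IG IG (fun x : G ↦ g * x) 1).map_smul t ξ
  have h1 := h.comp_mul t
  rw [← hs] at h1
  have h2 := isMIntegralCurve_Ioo_eq_of_contMDiff_boundaryless (t₀ := 0) (hv _) k h1
    (by rw [k0]; simp [h0])
  simpa [lieExp] using congrFun h2 1

theorem hasVelocity_lieExp (ξ : GroupLieAlgebra IG G) :
    HasVelocity IG (fun t : ℝ ↦ lieExp (t • ξ)) (1 : G) ξ := by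
  obtain ⟨γ, h0, h, hγ⟩ := exists_isMIntegralCurve_eq_lieExp ξ
  rw [funext hγ]
  refine ⟨h0, (h 0).congr_mfderiv ?_⟩
  -- `γ 0` equals `1` only propositionally, hence the substitution of a variable base point.
  have e : ∀ g : G, g = 1 → (mulInvariantVectorField ξ g : EG) = ξ := by
    rintro _ rfl
    have h1 : (fun x : G ↦ 1 * x) = id := funext one_mul
    rw [mulInvariantVectorField, h1, mfderiv_id]
    rfl
  exact congrArg (fun v : EG ↦ (1 : ℝ →L[ℝ] ℝ).smulRight v) (e _ h0)

end LieExp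

/-! ### The vertical lift -/

section VerticalLift

theorem OpenPartialHomeomorph.MDifferentiable.tangentMap_symm_tangentMap
    {E' H' N : Type*} [NormedAddCommGroup E'] [NormedSpace ℝ E'] [TopologicalSpace H']
    {I' : ModelWithCorners ℝ E' H'} [TopologicalSpace N] [ChartedSpace H' N]
    {E'' H'' N' : Type*} [NormedAddCommGroup E''] [NormedSpace ℝ E''] [TopologicalSpace H'']
    {I'' : ModelWithCorners ℝ E'' H''} [TopologicalSpace N'] [ChartedSpace H'' N']
    {e : OpenPartialHomeomorph N N'} (he : e.MDifferentiable I' I'') (x : TangentBundle I' N)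
    (hx : x.proj ∈ e.source) :
    tangentMap I'' I' e.symm (tangentMap I' I'' e x) = x := by
  rw [← tangentMap_comp_at x (he.mdifferentiableAt_symm (e.map_source hx))
    (he.mdifferentiableAt hx)]
  have h : e.symm ∘ e =ᶠ[𝓝 x.proj] id := e.eventually_left_inverse hx
  obtain ⟨q, u⟩ := x
  have h0 : (e.symm ∘ e) q = q := e.left_inv hx
  have h1 : (mfderiv I' I' (e.symm ∘ e) q u : E') = u := by
    rw [h.mfderiv_eq, mfderiv_id]
    rfl
  -- The fibers over `e⁻¹(e(q))` and `q` are compared by substituting the equality of base points.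
  have key : ∀ (r : N) (_ : r = q) (u' : E'), u' = u →
      (⟨r, u'⟩ : TangentBundle I' N) = ⟨q, u⟩ := by
    rintro _ rfl _ rfl
    rfl
  exact key _ h0 _ h1

variable {EM HM M : Type*} [NormedAddCommGroup EM] [NormedSpace ℝ EM]
  [TopologicalSpace HM] {IM : ModelWithCorners ℝ EM HM}
  [TopologicalSpace M] [ChartedSpace HM M]
  {V : Type*} [NormedAddCommGroup V] [NormedSpace ℝ V]
  {E : M → Type*} [TopologicalSpace (TotalSpace V E)]
  [∀ p, AddCommGroup (E p)] [∀ p, Module ℝ (E p)] [∀ p, TopologicalSpace (E p)]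
  [FiberBundle V E]

theorem IsSmoothLocalTrivialization.mdifferentiable {Φ : Trivialization V (π V E)}
    (hΦ : IsSmoothLocalTrivialization IM Φ) :
    Φ.toOpenPartialHomeomorph.MDifferentiable (IM.prod 𝓘(ℝ, V)) (IM.prod 𝓘(ℝ, V)) :=
  ⟨hΦ.smooth.mdifferentiableOn (by simp), hΦ.smooth_symm.mdifferentiableOn (by simp)⟩

/-- In a smooth local trivialization, the velocity of a curve in a single fiber has horizontal
component zero; its vertical component is the derivative of the curve read in the model fiber. -/
theorem HasVelocity.of_fiber {Φ : Trivialization V (π V E)}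
    (hΦ : IsSmoothLocalTrivialization IM Φ) {p : M} (hp : p ∈ Φ.baseSet) {f : ℝ → E p}
    {x : TotalSpace V E} {u : EM × V}
    (h : HasVelocity (IM.prod 𝓘(ℝ, V)) (fun t ↦ (⟨p, f t⟩ : TotalSpace V E)) x u) :
    (mfderiv (IM.prod 𝓘(ℝ, V)) (IM.prod 𝓘(ℝ, V)) Φ x u : EM × V).1 = 0 ∧
      HasDerivAt (fun t ↦ (Φ ⟨p, f t⟩).2)
        (mfderiv (IM.prod 𝓘(ℝ, V)) (IM.prod 𝓘(ℝ, V)) Φ x u : EM × V).2 0 := by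
  have hx : x ∈ Φ.source := by
    rw [← h.1]
    exact Φ.mem_source.2 hp
  have h1 := h.map (hΦ.mdifferentiable.mdifferentiableAt hx)
  refine ⟨?_, h1.snd.hasDerivAt⟩
  refine (h1.fst.congr (.of_eq (funext fun t ↦ ?_))).unique (HasVelocity.const (x := (Φ x).1))
  have hx' : x.proj = p := by rw [← h.1]
  have h2 : (Φ ⟨p, f t⟩).1 = p := Φ.coe_fst (Φ.mem_source.2 hp)
  exact ((Φ.coe_fst hx).trans (hx'.trans h2.symm))

variable [VectorBundle ℝ V E]

theorem isSmoothLocalTrivialization_of_mem [ContMDiffVectorBundle ∞ V E IM]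
    (e : Trivialization V (π V E)) [MemTrivializationAtlas e] :
    IsSmoothLocalTrivialization IM e :=
  ⟨inferInstance, e.contMDiffOn, e.contMDiffOn_symm⟩

variable (IM V) in
/-- The vertical lift along `F`: a vector of `E_p` is sent to the tangent vector at `F(p)` whose
image under the preferred local trivialization at `p` is vertical, with the same component in the
model fiber. The tangent vector is produced at `e⁻¹(e(F(p)))`, which is `F(p)`. -/
def verticalLift (F : ∀ p, E p) (p : M) :
    E p →ₗ[ℝ] TangentSpace (IM.prod 𝓘(ℝ, V)) (sectionMap V F p) :=
  letI D : EM × V →L[ℝ] EM × V := mfderiv (IM.prod 𝓘(ℝ, V)) (IM.prod 𝓘(ℝ, V))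
    (trivializationAt V E p).toOpenPartialHomeomorph.symm
    (trivializationAt V E p (sectionMap V F p))
  D.toLinearMap ∘ₗ LinearMap.inr ℝ EM V ∘ₗ (trivializationAt V E p).linearMapAt ℝ p

variable [ContMDiffVectorBundle ∞ V E IM]

/-- The vertical lift of `w` is the velocity of the straight line `t ↦ F(p) + t w` in `E_p`. -/
theorem hasVelocity_verticalLift (F : ∀ p, E p) (p : M) (w : E p) :
    HasVelocity (IM.prod 𝓘(ℝ, V)) (fun t : ℝ ↦ (⟨p, F p + t • w⟩ : TotalSpace V E))
      (sectionMap V F p) (verticalLift IM V F p w) := by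
  set e := trivializationAt V E p
  have hp : p ∈ e.baseSet := FiberBundle.mem_baseSet_trivializationAt' p
  have hx : sectionMap V F p ∈ e.source := e.mem_source.2 hp
  set L := e.continuousLinearEquivAt ℝ p hp
  have he := (isSmoothLocalTrivialization_of_mem (IM := IM) e).mdifferentiable
  have h1 : HasVelocity 𝓘(ℝ, V) (fun t : ℝ ↦ L (F p) + t • L w) (L (F p)) (L w) := by
    have h : HasDerivAt (fun t : ℝ ↦ L (F p) + t • L w) (L w) 0 := by
      simpa using ((hasDerivAt_id (0 : ℝ)).smul_const (L w)).const_add (L (F p))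
    simpa using h.hasVelocity
  have h2 := (HasVelocity.const (I' := IM) (x := p)).prodMk h1
  have h3 : (p, L (F p)) = e (sectionMap V F p) :=
    (e.apply_eq_prod_continuousLinearEquivAt ℝ p hp _).symm
  rw [h3] at h2
  have h4 := h2.map (he.mdifferentiableAt_symm (e.map_source hx))
  have h5 : (e.toOpenPartialHomeomorph.symm (e (sectionMap V F p))) = sectionMap V F p :=
    e.left_inv hx
  have h6 : (verticalLift IM V F p w : EM × V) = mfderiv (IM.prod 𝓘(ℝ, V)) (IM.prod 𝓘(ℝ, V))
      e.toOpenPartialHomeomorph.symm (e (sectionMap V F p)) ((0, L w) : EM × V) := by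
    have h7 : L w = e.linearMapAt ℝ p w :=
      congrFun (e.coe_continuousLinearEquivAt_eq hp) w
    rw [h7]
    rfl
  rw [← h6, h5] at h4
  refine h4.congr (.of_eq (funext fun t ↦ ?_))
  refine Eq.trans ?_ (e.symm_apply_eq_mk_continuousLinearEquivAt_symm (R := ℝ) p hp _).symm
  congr 1
  apply L.injective
  rw [map_add, map_smul]
  exact (L.apply_symm_apply _).symm

theorem isVerticalLift_verticalLift (F : ∀ p, E p) :
    IsVerticalLift IM V F (fun p ↦ verticalLift IM V F p) := by
  intro Φ hΦ p hp w v hv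
  obtain ⟨h1, h2⟩ := (hasVelocity_verticalLift (IM := IM) F p w).of_fiber hΦ hp
  refine Prod.ext h1 (h2.unique ?_)
  have := hΦ.linear
  have h3 : ∀ t : ℝ, (Φ ⟨p, F p + t • w⟩).2 = (Φ ⟨p, F p⟩).2 + t • v := by
    intro t
    rw [(Φ.linear ℝ hp).map_add, (Φ.linear ℝ hp).map_smul, hv]
  simp only [h3]
  simpa using ((hasDerivAt_id (0 : ℝ)).smul_const v).const_add (Φ ⟨p, F p⟩).2

theorem mfderiv_verticalLift {Φ : Trivialization V (π V E)} (hΦ : IsSmoothLocalTrivialization IM Φ)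
    (F : ∀ p, E p) {p : M} (hp : p ∈ Φ.baseSet) (w : E p) :
    (mfderiv (IM.prod 𝓘(ℝ, V)) (IM.prod 𝓘(ℝ, V)) Φ (sectionMap V F p)
      (verticalLift IM V F p w) : EM × V) = (0, (Φ ⟨p, w⟩).2) :=
  isVerticalLift_verticalLift F Φ hΦ p hp w _ (Φ.mk_proj_snd (Φ.mem_source.2 hp)).symm

theorem IsVerticalLift.eq_verticalLift {F : ∀ p, E p}
    {ι : ∀ p, E p → TangentSpace (IM.prod 𝓘(ℝ, V)) (sectionMap V F p)}
    (hι : IsVerticalLift IM V F ι) (p : M) (w : E p) : ι p w = verticalLift IM V F p w := by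
  have he := isSmoothLocalTrivialization_of_mem (IM := IM) (trivializationAt V E p)
  have hp : p ∈ (trivializationAt V E p).baseSet := FiberBundle.mem_baseSet_trivializationAt' p
  have hx : sectionMap V F p ∈ (trivializationAt V E p).source :=
    (trivializationAt V E p).mem_source.2 hp
  refine he.mdifferentiable.mfderiv_injective hx ?_
  exact (hι _ he p hp w _ (Trivialization.mk_proj_snd _
    ((Trivialization.mem_source _).2 hp)).symm).trans (mfderiv_verticalLift he F hp w).symm

theorem verticalLift_injective (F : ∀ p, E p) (p : M) :
    Function.Injective (verticalLift IM V F p) := by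
  intro w w' h
  have he := isSmoothLocalTrivialization_of_mem (IM := IM) (trivializationAt V E p)
  have hp : p ∈ (trivializationAt V E p).baseSet := FiberBundle.mem_baseSet_trivializationAt' p
  have h1 := mfderiv_verticalLift he F hp w
  rw [h, mfderiv_verticalLift he F hp w'] at h1
  exact ((trivializationAt V E p).continuousLinearEquivAt ℝ p hp).injective
    (Prod.ext_iff.1 h1).2.symm

theorem injective_mk_verticalLift (F : ∀ p, E p) :
    Function.Injective (fun x : TotalSpace V E ↦
      (⟨sectionMap V F x.proj, verticalLift IM V F x.proj x.snd⟩ :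
        TangentBundle (IM.prod 𝓘(ℝ, V)) (TotalSpace V E))) := by
  rintro ⟨p, w⟩ ⟨q, w'⟩ h
  obtain rfl : p = q := congrArg (fun z : TangentBundle (IM.prod 𝓘(ℝ, V)) (TotalSpace V E) ↦
    z.proj.proj) h
  congr 1
  simp only [TotalSpace.mk.injEq, heq_eq_eq, true_and] at h
  exact verticalLift_injective F p h

/-- In a local trivialization `e`, the vertical lift is the composition of the tangent map of `e⁻¹`
with the vector field `x ↦ (0, e(x))` along `x ↦ e(F(π(x)))`, which is visibly smooth. -/
theorem contMDiff_mk_verticalLift [IsManifold IM ∞ M] (F : ∀ p, E p)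
    (hF : ContMDiff IM (IM.prod 𝓘(ℝ, V)) ∞ (sectionMap V F)) :
    ContMDiff (IM.prod 𝓘(ℝ, V)) (IM.prod 𝓘(ℝ, V)).tangent ∞ (fun x : TotalSpace V E ↦
      (⟨sectionMap V F x.proj, verticalLift IM V F x.proj x.snd⟩ :
        TangentBundle (IM.prod 𝓘(ℝ, V)) (TotalSpace V E))) := by
  have : IsManifold IM 1 M := IsManifold.of_le (n := ∞) ENat.LEInfty.out
  have : IsManifold (IM.prod 𝓘(ℝ, V)) ∞ (TotalSpace V E) := Bundle.TotalSpace.isManifold V E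
  have : IsManifold (IM.prod 𝓘(ℝ, V)) 1 (TotalSpace V E) :=
    IsManifold.of_le (n := ∞) ENat.LEInfty.out
  intro x₀
  set e := trivializationAt V E x₀.proj
  have he := isSmoothLocalTrivialization_of_mem (IM := IM) e
  have hx₀ : x₀ ∈ e.source := FiberBundle.mem_trivializationAt_proj_source
  have hFx {x : TotalSpace V E} (hx : x ∈ e.source) : sectionMap V F x.proj ∈ e.source := by
    rw [e.mem_source] at hx ⊢
    exact hx
  let s : TotalSpace V E → TangentBundle (IM.prod 𝓘(ℝ, V)) (M × V) := fun x ↦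
    (equivTangentBundleProd IM M 𝓘(ℝ, V) V).symm
      (⟨x.proj, 0⟩, ⟨(e (sectionMap V F x.proj)).2, (e x).2⟩)
  have hs : ContMDiffAt (IM.prod 𝓘(ℝ, V)) (IM.prod 𝓘(ℝ, V)).tangent ∞ s x₀ := by
    have hπ : ContMDiffAt (IM.prod 𝓘(ℝ, V)) IM ∞ (fun x : TotalSpace V E ↦ x.proj) x₀ :=
      (contMDiff_proj E).contMDiffAt
    have h1 : ContMDiffAt (IM.prod 𝓘(ℝ, V)) IM.tangent ∞
        (fun x : TotalSpace V E ↦ (⟨x.proj, 0⟩ : TangentBundle IM M)) x₀ :=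
      (contMDiff_zeroSection ℝ (TangentSpace IM : M → Type _)).contMDiffAt.comp x₀ hπ
    have h2 : ContMDiffAt (IM.prod 𝓘(ℝ, V)) 𝓘(ℝ, V) ∞
        (fun x : TotalSpace V E ↦ (e x).2) x₀ :=
      contMDiffAt_snd.comp x₀ (he.smooth.contMDiffAt (e.open_source.mem_nhds hx₀))
    have h3 : ContMDiffAt (IM.prod 𝓘(ℝ, V)) 𝓘(ℝ, V) ∞
        (fun x : TotalSpace V E ↦ (e (sectionMap V F x.proj)).2) x₀ :=
      contMDiffAt_snd.comp x₀ ((he.smooth.contMDiffAt (e.open_source.mem_nhds (hFx hx₀))).comp x₀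
        (hF.contMDiffAt.comp x₀ hπ))
    have h4 : ContMDiffAt (IM.prod 𝓘(ℝ, V)) 𝓘(ℝ, V).tangent ∞
        (fun x : TotalSpace V E ↦
          (⟨(e (sectionMap V F x.proj)).2, (e x).2⟩ : TangentBundle 𝓘(ℝ, V) V)) x₀ := by
      refine contMDiffAt_totalSpace.2 ⟨h3, ?_⟩
      simpa using h2
    exact (contMDiff_equivTangentBundleProd_symm (n := ∞)).contMDiffAt.comp x₀ (h1.prodMk h4)
  have hT := he.smooth_symm.contMDiffOn_tangentMapWithin (m := ∞) (by simp)
    e.open_target.uniqueMDiffOn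
  have hopen : IsOpen (π (EM × V) (TangentSpace (IM.prod 𝓘(ℝ, V)) : M × V → Type _) ⁻¹'
      e.target) := e.open_target.preimage (FiberBundle.continuous_proj _ _)
  have hes {x : TotalSpace V E} (hx : x ∈ e.source) :
      s x = tangentMap (IM.prod 𝓘(ℝ, V)) (IM.prod 𝓘(ℝ, V)) e
        ⟨sectionMap V F x.proj, verticalLift IM V F x.proj x.snd⟩ := by
    have h1 : e (sectionMap V F x.proj) = (x.proj, (e (sectionMap V F x.proj)).2) :=
      (e.mk_proj_snd (hFx hx)).symm
    have h2 := mfderiv_verticalLift he F (e.mem_source.1 hx) x.snd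
    have key : ∀ (y y' : M × V) (_ : y = y') (u u' : EM × V), u = u' →
        (⟨y, u⟩ : TangentBundle (IM.prod 𝓘(ℝ, V)) (M × V)) = ⟨y', u'⟩ := by
      rintro _ _ rfl _ _ rfl
      rfl
    exact key _ _ h1.symm _ _ h2.symm
  have hst {x : TotalSpace V E} (hx : x ∈ e.source) : (s x).proj ∈ e.target := by
    rw [hes hx]
    exact e.map_source (hFx hx)
  refine ((hT.contMDiffAt (hopen.mem_nhds (hst hx₀))).comp x₀ hs).congr_of_eventuallyEq ?_
  filter_upwards [e.open_source.mem_nhds hx₀] with x hx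
  rw [Function.comp_apply, tangentMapWithin_eq_tangentMap
    (e.open_target.uniqueMDiffOn _ (hst hx)) (he.mdifferentiable.mdifferentiableAt_symm (hst hx)),
    hes hx]
  exact (he.mdifferentiable.tangentMap_symm_tangentMap _ (hFx hx)).symm

/-- A curve in the fiber `E_p` which passes through `F(p)` at time `0` and is differentiable there
as a curve in `E` is differentiable at `0` as a curve in the vector space `E_p`. The vertical lift
identifies its derivative with its velocity. -/
theorem HasVelocity.exists_tendsto_verticalLift_eq {F : ∀ p, E p} {p : M} {f : ℝ → E p} {u : EM × V}
    (h : HasVelocity (IM.prod 𝓘(ℝ, V)) (fun t ↦ (⟨p, f t⟩ : TotalSpace V E))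
      (sectionMap V F p) u) :
    ∃ v : E p, Tendsto (fun t : ℝ ↦ t⁻¹ • (f t - F p)) (𝓝[≠] 0) (𝓝 v) ∧
      (verticalLift IM V F p v : EM × V) = u := by
  set e := trivializationAt V E p
  have hp : p ∈ e.baseSet := FiberBundle.mem_baseSet_trivializationAt' p
  set L := e.continuousLinearEquivAt ℝ p hp
  have he := isSmoothLocalTrivialization_of_mem (IM := IM) e
  obtain ⟨h1, h2⟩ := h.of_fiber he hp
  set u' : EM × V := mfderiv (IM.prod 𝓘(ℝ, V)) (IM.prod 𝓘(ℝ, V)) e (sectionMap V F p) u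
    with hu'
  refine ⟨L.symm u'.2, ?_, ?_⟩
  · have h0 : f 0 = F p := by
      have h0 := h.1
      simpa [sectionMap] using h0
    have h3 := L.symm.continuous.continuousAt.tendsto.comp (hasDerivAt_iff_tendsto_slope_zero.1 h2)
    refine h3.congr fun t ↦ ?_
    have h4 : ∀ t, (e ⟨p, f t⟩).2 = L (f t) := fun t ↦ rfl
    apply L.injective
    simp only [h4, Function.comp_apply, zero_add, h0]
    rw [ContinuousLinearEquiv.apply_symm_apply, map_smul, map_sub]
    rfl
  · refine he.mdifferentiable.mfderiv_injective (e.mem_source.2 hp) ?_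
    refine (mfderiv_verticalLift he F hp _).trans ?_
    refine Prod.ext h1.symm ?_
    exact L.apply_symm_apply u'.2

end VerticalLift

/-! ### The projection onto the tangent space of a section -/

/-- In a manifold without boundary every tangent vector is the velocity of a smooth curve: a
straight line in the preferred chart. -/
theorem exists_contMDiffOn_hasVelocity {E' H' N : Type*} [NormedAddCommGroup E'] [NormedSpace ℝ E']
    [TopologicalSpace H'] (I' : ModelWithCorners ℝ E' H') [TopologicalSpace N] [ChartedSpace H' N]
    [IsManifold I' ∞ N] [BoundarylessManifold I' N] (x : N) (v : E') :
    ∃ (c : ℝ → N) (ε : ℝ), 0 < ε ∧ ContMDiffOn 𝓘(ℝ, ℝ) I' ∞ c (Ioo (-ε) ε) ∧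
      HasVelocity I' c x v := by
  have : IsManifold I' 1 N := IsManifold.of_le (n := ∞) ENat.LEInfty.out
  have hint : I'.IsInteriorPoint x := BoundarylessManifold.isInteriorPoint
  have hnhds : (extChartAt I' x).target ∈ 𝓝 (extChartAt I' x x) :=
    mem_interior_iff_mem_nhds.1 (ModelWithCorners.isInteriorPoint_iff.1 hint)
  set y : E' := extChartAt I' x x
  have hl : ContDiff ℝ ∞ (fun t : ℝ ↦ y + t • v) := by fun_prop
  have hev : ∀ᶠ t : ℝ in 𝓝 0, y + t • v ∈ (extChartAt I' x).target :=
    hl.continuous.continuousAt.eventually_mem (by simpa using hnhds)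
  obtain ⟨ε, hε, hball⟩ := Metric.eventually_nhds_iff_ball.1 hev
  have hsmooth : ContMDiffOn 𝓘(ℝ, ℝ) I' ∞ (fun t : ℝ ↦ (extChartAt I' x).symm (y + t • v))
      (Ioo (-ε) ε) := by
    refine (contMDiffOn_extChartAt_symm x).comp hl.contMDiff.contMDiffOn fun t ht ↦ hball t ?_
    simpa [Real.ball_eq_Ioo] using ht
  refine ⟨_, ε, hε, hsmooth, ?_⟩
  have h1 : HasVelocity 𝓘(ℝ, E') (fun t : ℝ ↦ y + t • v) y v := by
    have h : HasDerivAt (fun t : ℝ ↦ y + t • v) v 0 := by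
      simpa using ((hasDerivAt_id (0 : ℝ)).smul_const v).const_add y
    simpa using h.hasVelocity
  have hmem : Ioo (-ε) ε ∈ 𝓝 (0 : ℝ) := Ioo_mem_nhds (by linarith) hε
  have hc := (hsmooth.contMDiffAt hmem).mdifferentiableAt (by simp)
  refine HasVelocity.of_mdifferentiableAt hc ?_ ?_
  · simp [y]
  have h0 : (extChartAt I' x).symm (y + (0 : ℝ) • v) = x := by simp [y]
  have h2 : HasVelocity I' (fun t : ℝ ↦ (extChartAt I' x).symm (y + t • v)) x _ :=
    HasVelocity.of_mdifferentiableAt hc h0 rfl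
  -- Applying the chart again recovers the straight line, and the derivative of the chart at its
  -- own base point is the identity.
  have h3 := h2.map (mdifferentiableAt_extChartAt (I := I') (mem_chart_source H' x))
  have h4 : HasVelocity 𝓘(ℝ, E')
      (fun t : ℝ ↦ extChartAt I' x ((extChartAt I' x).symm (y + t • v))) y v := by
    refine h1.congr ?_
    filter_upwards [hev] with t ht
    exact (extChartAt I' x).right_inv ht
  have h5 := h3.unique h4
  rw [mfderiv_extChartAt_self] at h5
  exact h5

section Projection

variable {EM HM M : Type*} [NormedAddCommGroup EM] [NormedSpace ℝ EM]
  [TopologicalSpace HM] {IM : ModelWithCorners ℝ EM HM}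
  [TopologicalSpace M] [ChartedSpace HM M]
  {V : Type*} [NormedAddCommGroup V] [NormedSpace ℝ V]
  {E : M → Type*} [TopologicalSpace (TotalSpace V E)]
  [∀ p, TopologicalSpace (E p)] [FiberBundle V E] {F : ∀ p, E p}

theorem mdifferentiableAt_proj (x : TotalSpace V E) :
    MDifferentiableAt (IM.prod 𝓘(ℝ, V)) IM (TotalSpace.proj : TotalSpace V E → M) x :=
  (contMDiff_proj (n := ∞) E).contMDiffAt.mdifferentiableAt (by simp)

theorem sectionProj_apply (hF : MDifferentiable IM (IM.prod 𝓘(ℝ, V)) (sectionMap V F)) (p : M)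
    (u : TangentSpace (IM.prod 𝓘(ℝ, V)) (sectionMap V F p)) :
    sectionProj IM V F p u = mfderiv IM (IM.prod 𝓘(ℝ, V)) (sectionMap V F) p
      (mfderiv (IM.prod 𝓘(ℝ, V)) IM (TotalSpace.proj : TotalSpace V E → M) (sectionMap V F p) u) :=
  congrArg (fun D : EM × V →L[ℝ] EM × V ↦ D u)
    (mfderiv_comp (sectionMap V F p) (hF p) (mdifferentiableAt_proj (sectionMap V F p)))

theorem mfderiv_proj_mfderiv_sectionMap
    (hF : MDifferentiable IM (IM.prod 𝓘(ℝ, V)) (sectionMap V F)) (p : M) (u : TangentSpace IM p) :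
    mfderiv (IM.prod 𝓘(ℝ, V)) IM (TotalSpace.proj : TotalSpace V E → M) (sectionMap V F p)
      (mfderiv IM (IM.prod 𝓘(ℝ, V)) (sectionMap V F) p u) = u := by
  have h1 : (TotalSpace.proj : TotalSpace V E → M) ∘ sectionMap V F = id := rfl
  have h2 := mfderiv_comp p (mdifferentiableAt_proj (IM := IM) (sectionMap V F p)) (hF p)
  rw [h1, mfderiv_id] at h2
  exact (congrArg (fun D : EM →L[ℝ] EM ↦ D u) h2).symm

theorem sectionProj_mfderiv_sectionMap
    (hF : MDifferentiable IM (IM.prod 𝓘(ℝ, V)) (sectionMap V F)) (p : M) (u : TangentSpace IM p) :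
    sectionProj IM V F p (mfderiv IM (IM.prod 𝓘(ℝ, V)) (sectionMap V F) p u) =
      mfderiv IM (IM.prod 𝓘(ℝ, V)) (sectionMap V F) p u := by
  rw [sectionProj_apply hF, mfderiv_proj_mfderiv_sectionMap hF]

theorem sectionProj_idem (hF : MDifferentiable IM (IM.prod 𝓘(ℝ, V)) (sectionMap V F)) (p : M)
    (u : TangentSpace (IM.prod 𝓘(ℝ, V)) (sectionMap V F p)) :
    sectionProj IM V F p (sectionProj IM V F p u) = sectionProj IM V F p u := by
  rw [sectionProj_apply hF p u]
  exact sectionProj_mfderiv_sectionMap hF p _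

theorem range_sectionProj (hF : MDifferentiable IM (IM.prod 𝓘(ℝ, V)) (sectionMap V F)) (p : M) :
    range (sectionProj IM V F p) = range (mfderiv IM (IM.prod 𝓘(ℝ, V)) (sectionMap V F) p) := by
  ext u
  constructor
  · rintro ⟨w, rfl⟩
    exact ⟨_, (sectionProj_apply hF p w).symm⟩
  · rintro ⟨w, rfl⟩
    exact ⟨_, sectionProj_mfderiv_sectionMap hF p w⟩

/-- A curve `γ` in the image of `F` satisfies `γ = F ∘ π ∘ γ`, so that its velocity is fixed by the
projection; conversely, `F` maps smooth curves in the base to smooth curves in its image. -/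
theorem range_sectionProj_eq_submanifoldTangent [IsManifold IM ∞ M] [BoundarylessManifold IM M]
    (hF : ContMDiff IM (IM.prod 𝓘(ℝ, V)) ∞ (sectionMap V F)) (p : M) :
    range (sectionProj IM V F p) =
      submanifoldTangent (IM.prod 𝓘(ℝ, V)) (range (sectionMap V F)) (sectionMap V F p) := by
  have hF' : MDifferentiable IM (IM.prod 𝓘(ℝ, V)) (sectionMap V F) := hF.mdifferentiable (by simp)
  ext u
  constructor
  · rw [range_sectionProj hF']
    rintro ⟨w, rfl⟩
    obtain ⟨c, ε, hε, hc, hcv⟩ := exists_contMDiffOn_hasVelocity IM p w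
    exact ⟨fun t ↦ sectionMap V F (c t), ε, hε, hF.comp_contMDiffOn hc, fun t _ ↦ ⟨c t, rfl⟩,
      congrArg (sectionMap V F) hcv.1, (hcv.map (hF' p)).mfderiv_apply_one⟩
  · rintro ⟨γ, ε, hε, hγ, hγF, h0, hγv⟩
    have hmem : Ioo (-ε) ε ∈ 𝓝 (0 : ℝ) := Ioo_mem_nhds (by linarith) hε
    have h1 : HasVelocity (IM.prod 𝓘(ℝ, V)) γ (sectionMap V F p) u :=
      .of_mdifferentiableAt ((hγ.contMDiffAt hmem).mdifferentiableAt (by simp)) h0 hγv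
    have h2 : HasVelocity (IM.prod 𝓘(ℝ, V)) _ _ (sectionProj IM V F p u) :=
      h1.map (f := sectionMap V F ∘ TotalSpace.proj)
        ((hF' p).comp (sectionMap V F p) (mdifferentiableAt_proj (sectionMap V F p)))
    refine ⟨u, h2.unique (h1.congr ?_)⟩
    filter_upwards [hmem] with t ht
    obtain ⟨q, hq⟩ := hγF t ht
    rw [← hq]
    rfl

end Projection

/-! ### The Lie derivative of a section -/

namespace FiberLinearRightAction

variable {EM HM M : Type*} [NormedAddCommGroup EM] [NormedSpace ℝ EM]
  [TopologicalSpace HM] {IM : ModelWithCorners ℝ EM HM}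
  [TopologicalSpace M] [ChartedSpace HM M]
  {EG HG : Type*} [NormedAddCommGroup EG] [NormedSpace ℝ EG]
  [TopologicalSpace HG] {IG : ModelWithCorners ℝ EG HG}
  {G : Type*} [TopologicalSpace G] [ChartedSpace HG G] [Group G]
  {V : Type*} [NormedAddCommGroup V] [NormedSpace ℝ V]
  {E : M → Type*} [TopologicalSpace (TotalSpace V E)]
  [∀ p, AddCommGroup (E p)] [∀ p, Module ℝ (E p)] [∀ p, TopologicalSpace (E p)]
  [FiberBundle V E] (Θ : FiberLinearRightAction IM IG G V E)

theorem act_one (x : TotalSpace V E) : Θ.act x 1 = x := Θ.map_one x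

theorem act_act (x : TotalSpace V E) (g h : G) : Θ.act (Θ.act x g) h = Θ.act x (g * h) :=
  Θ.map_mul x g h

theorem mdifferentiable_act : MDifferentiable ((IM.prod 𝓘(ℝ, V)).prod IG) (IM.prod 𝓘(ℝ, V))
    (fun z : TotalSpace V E × G ↦ Θ.act z.1 z.2) :=
  Θ.smooth.mdifferentiable (by simp)

variable [FiniteDimensional ℝ EG] [LieGroup IG ∞ G] [BoundarylessManifold IG G] [T2Space G]

theorem hasVelocity_generator (ξ : GroupLieAlgebra IG G) (x : TotalSpace V E) :
    HasVelocity (IM.prod 𝓘(ℝ, V)) (fun t : ℝ ↦ Θ.act x (lieExp (t • ξ))) x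
      (Θ.generator ξ x) := by
  have h := ((HasVelocity.const (I' := IM.prod 𝓘(ℝ, V)) (x := x)).prodMk
    (hasVelocity_lieExp ξ)).map (Θ.mdifferentiable_act (x, 1))
  exact .of_mdifferentiableAt h.mdifferentiableAt (h.1.trans (Θ.act_one x)) rfl

/-- The velocity of the curve `x(t) = K_{exp (t ξ)} F (p)` is obtained by differentiating
`Θ_{exp (t ξ)}(x(t)) = F(θ_{exp (t ξ)}(p))`. The left side contributes the velocity of `x` and the
generator, the right side the projection of the generator. -/
theorem hasVelocity_transform {F : ∀ p, E p}
    (hF : MDifferentiable IM (IM.prod 𝓘(ℝ, V)) (sectionMap V F))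
    (ξ : GroupLieAlgebra IG G) (p : M) :
    HasVelocity (IM.prod 𝓘(ℝ, V))
      (fun t : ℝ ↦ (⟨p, Θ.transform (lieExp (t • ξ)) F p⟩ : TotalSpace V E)) (sectionMap V F p)
      (-(Θ.generator ξ (sectionMap V F p) -
        sectionProj IM V F p (Θ.generator ξ (sectionMap V F p)))) := by
  set c : ℝ → G := fun t ↦ lieExp (t • ξ)
  set x₀ := sectionMap V F p
  set u₀ : EM × V := Θ.generator ξ x₀
  set u₁ : EM × V := sectionProj IM V F p u₀
  have hc : HasVelocity IG c 1 ξ := hasVelocity_lieExp ξ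
  have hgen : HasVelocity (IM.prod 𝓘(ℝ, V)) (fun t ↦ Θ.act x₀ (c t)) x₀ u₀ :=
    Θ.hasVelocity_generator ξ x₀
  have hy : HasVelocity (IM.prod 𝓘(ℝ, V)) (fun t ↦ sectionMap V F (Θ.base p (c t))) x₀ u₁ :=
    hgen.map (f := sectionMap V F ∘ TotalSpace.proj)
      ((hF p).comp x₀ (mdifferentiableAt_proj x₀))
  set x : ℝ → TotalSpace V E := fun t ↦ ⟨p, Θ.transform (c t) F p⟩
  have hx (t : ℝ) : x t = Θ.act (sectionMap V F (Θ.base p (c t))) (c t)⁻¹ :=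
    Θ.mk_transform (c t) F p
  have hxy (t : ℝ) : Θ.act (x t) (c t) = sectionMap V F (Θ.base p (c t)) := by
    rw [hx, act_act, inv_mul_cancel, act_one]
  have hx0 : x 0 = x₀ := by
    have h0 := hxy 0
    rw [hc.1, act_one] at h0
    rw [h0, ← hc.1]
    exact hy.1
  -- Only the differentiability of `t ↦ (c t)⁻¹` matters, and not its velocity.
  have hinv := hc.map (f := fun g : G ↦ g⁻¹)
    ((contMDiff_inv IG ∞).mdifferentiable (by simp) 1)
  have hxd : MDifferentiableAt 𝓘(ℝ, ℝ) (IM.prod 𝓘(ℝ, V)) x 0 := by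
    rw [funext hx]
    exact ((hy.prodMk hinv).map (Θ.mdifferentiable_act _)).mdifferentiableAt
  obtain ⟨u, hu⟩ : ∃ u : EM × V, HasVelocity (IM.prod 𝓘(ℝ, V)) x x₀ u :=
    ⟨_, .of_mdifferentiableAt hxd hx0 rfl⟩
  have h := HasVelocity.map₂ (f := Θ.act) (Θ.mdifferentiable_act (x₀, 1)) hu hc
    (by simpa only [act_one] using hu) hgen
  simp only [hxy] at h
  have h1 : u = -(u₀ - u₁) := by
    rw [neg_sub, ← h.unique hy, add_sub_cancel_right]
  rwa [h1] at hu

variable [VectorBundle ℝ V E] [ContMDiffVectorBundle ∞ V E IM]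

theorem tendsto_lieQuotient {F : ∀ p, E p}
    (hF : MDifferentiable IM (IM.prod 𝓘(ℝ, V)) (sectionMap V F))
    (ξ : GroupLieAlgebra IG G) (p : M) :
    Tendsto (Θ.lieQuotient ξ F p) (𝓝[≠] 0) (𝓝 (Θ.lieDeriv ξ F p)) ∧
      verticalLift IM V F p (Θ.lieDeriv ξ F p) =
        -(Θ.generator ξ (sectionMap V F p) -
          sectionProj IM V F p (Θ.generator ξ (sectionMap V F p))) := by
  have : T2Space (E p) := ((trivializationAt V E p).continuousLinearEquivAt ℝ p
    (FiberBundle.mem_baseSet_trivializationAt' p)).symm.toHomeomorph.t2Space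
  obtain ⟨v, hv, hιv⟩ :=
    (Θ.hasVelocity_transform hF ξ p).exists_tendsto_verticalLift_eq (IM := IM) (E := E)
  have h : Θ.lieDeriv ξ F p = v := hv.limUnder_eq
  rw [h]
  exact ⟨hv, hιv⟩

theorem lieDeriv_eq_zero_iff [IsManifold IM ∞ M] [BoundarylessManifold IM M] {F : ∀ p, E p}
    (hF : ContMDiff IM (IM.prod 𝓘(ℝ, V)) ∞ (sectionMap V F)) (ξ : GroupLieAlgebra IG G) (p : M) :
    Θ.lieDeriv ξ F p = 0 ↔ Θ.generator ξ (sectionMap V F p) ∈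
      submanifoldTangent (IM.prod 𝓘(ℝ, V)) (range (sectionMap V F)) (sectionMap V F p) := by
  have hF' : MDifferentiable IM (IM.prod 𝓘(ℝ, V)) (sectionMap V F) := hF.mdifferentiable (by simp)
  rw [← range_sectionProj_eq_submanifoldTangent hF p,
    ← (verticalLift_injective (IM := IM) (V := V) F p).eq_iff, map_zero,
    (Θ.tendsto_lieQuotient hF' ξ p).2, neg_eq_zero, sub_eq_zero]
  constructor
  · intro h
    exact ⟨_, h.symm⟩
  · rintro ⟨u, hu⟩
    rw [← hu, sectionProj_idem hF']

end FiberLinearRightAction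

end

theorem mainTheorem5
    -- the base manifold `M`
    {EM HM M : Type*} [NormedAddCommGroup EM] [NormedSpace ℝ EM] [FiniteDimensional ℝ EM]
    [TopologicalSpace HM] (IM : ModelWithCorners ℝ EM HM)
    [TopologicalSpace M] [ChartedSpace HM M] [IsManifold IM ∞ M] [BoundarylessManifold IM M]
    -- the Lie group `G`
    {EG HG G : Type*} [NormedAddCommGroup EG] [NormedSpace ℝ EG] [FiniteDimensional ℝ EG]
    [TopologicalSpace HG] (IG : ModelWithCorners ℝ EG HG)
    [TopologicalSpace G] [ChartedSpace HG G] [Group G] [LieGroup IG ∞ G]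
    [BoundarylessManifold IG G] [T2Space G]
    -- the vector bundle `E → M` with model fiber `V`
    {V : Type*} [NormedAddCommGroup V] [NormedSpace ℝ V] [FiniteDimensional ℝ V]
    {E : M → Type*} [TopologicalSpace (TotalSpace V E)]
    [∀ p, AddCommGroup (E p)] [∀ p, Module ℝ (E p)] [∀ p, TopologicalSpace (E p)]
    [FiberBundle V E] [VectorBundle ℝ V E] [ContMDiffVectorBundle ∞ V E IM]
    -- the fiber-linear action and the smooth section
    (Θ : FiberLinearRightAction IM IG G V E)
    (F : ∀ p, E p) (hF : ContMDiff IM (IM.prod 𝓘(ℝ, V)) ∞ (sectionMap V F)) :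
    ∃ ι : ∀ p, E p →ₗ[ℝ] TangentSpace (IM.prod 𝓘(ℝ, V)) (sectionMap V F p),
      -- `ι` is the (well-defined and unique) vertical lift along `F`
      IsVerticalLift IM V F (fun p ↦ ι p) ∧
      (∀ ι' : ∀ p, E p → TangentSpace (IM.prod 𝓘(ℝ, V)) (sectionMap V F p),
        IsVerticalLift IM V F ι' → ∀ p w, ι' p w = ι p w) ∧
      -- it is a smooth injective vector bundle homomorphism `E → TE` over `F : M → E`
      ContMDiff (IM.prod 𝓘(ℝ, V)) (IM.prod 𝓘(ℝ, V)).tangent ∞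
        (fun x : TotalSpace V E ↦ (⟨sectionMap V F x.proj, ι x.proj x.snd⟩ :
          TangentBundle (IM.prod 𝓘(ℝ, V)) (TotalSpace V E))) ∧
      Function.Injective
        (fun x : TotalSpace V E ↦ (⟨sectionMap V F x.proj, ι x.proj x.snd⟩ :
          TangentBundle (IM.prod 𝓘(ℝ, V)) (TotalSpace V E))) ∧
      -- `P` is a linear projection onto the tangent space of the image of `F`
      (∀ p : M,
        (∀ v, sectionProj IM V F p (sectionProj IM V F p v) = sectionProj IM V F p v) ∧
        range (sectionProj IM V F p) =
          submanifoldTangent (IM.prod 𝓘(ℝ, V)) (range (sectionMap V F)) (sectionMap V F p) ∧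
        range (sectionProj IM V F p) =
          range (mfderiv IM (IM.prod 𝓘(ℝ, V)) (sectionMap V F) p)) ∧
      -- the Lie derivative exists, and is characterized by the projection of the generator
      ∀ ξ : GroupLieAlgebra IG G,
        Θ.MemLieDomain ξ F ∧
        ∀ p : M,
          ι p (Θ.lieDeriv ξ F p) =
            -(Θ.generator ξ (sectionMap V F p) -
              sectionProj IM V F p (Θ.generator ξ (sectionMap V F p))) ∧
          (Θ.lieDeriv ξ F p = 0 ↔
            Θ.generator ξ (sectionMap V F p) ∈
              submanifoldTangent (IM.prod 𝓘(ℝ, V)) (range (sectionMap V F))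
                (sectionMap V F p)) := by
  have hF' : MDifferentiable IM (IM.prod 𝓘(ℝ, V)) (sectionMap V F) := hF.mdifferentiable (by simp)
  refine ⟨verticalLift IM V F, isVerticalLift_verticalLift F, fun ι' hι' ↦ hι'.eq_verticalLift,
    contMDiff_mk_verticalLift F hF, injective_mk_verticalLift F,
    fun p ↦ ⟨sectionProj_idem hF' p, range_sectionProj_eq_submanifoldTangent hF p,
      range_sectionProj hF' p⟩,
    fun ξ ↦ ⟨fun p ↦ ⟨_, (Θ.tendsto_lieQuotient hF' ξ p).1⟩,
      fun p ↦ ⟨(Θ.tendsto_lieQuotient hF' ξ p).2, Θ.lieDeriv_eq_zero_iff hF ξ p⟩⟩⟩
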